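/- Let $X$ be a real random variable with $\mathbb{E}[X]=0$ and $\mathbb{E}[X^2]=1$, let $Z\sim\mathcal N(0,1)$ be independent of $X$, and for $\gamma>0$ put $Y_\gamma=\sqrt{\gamma}\,X+Z$. Let $I(X;Y_\gamma)=D(P_{X,Y_\gamma}\,\|\,P_X\otimes P_{Y_\gamma})$ be the mutual information and $C(\gamma)=\tfrac12\log(1+\gamma)$ the Gaussian channel capacity (all logarithms are natural). Denote by $d_{\mathrm{KS}}(P,Q)=\sup_{x\in\mathbb{R}}|F_P(x)-F_Q(x)|$ the Kolmogorov-Smirnov distance, where $F_P(x)=P((-\infty,x])$. If $C(\gamma)-I(X;Y_\gamma)\le\epsilon$ and $\gamma>4\epsilon$, then $$d_{\mathrm{KS}}(P_X,\mathcal N(0,1))\le a_0\sqrt{\frac{2}{\gamma\log\left(\frac{\gamma}{4\epsilon}\right)}}+a_1(1+\gamma)(\gamma\epsilon)^{1/4}\sqrt{2\log\left(\frac{\gamma}{4\epsilon}\right)},$$ with the absolute constants $a_0=24/\pi^{3/2}$ and $a_1=\sqrt2/\pi$. (The hypotheses force $\epsilon\ge 0$; for $\epsilon=0$ the right-hand side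 is read as $0$, its limit as $\epsilon\downarrow0$.) -/

import Mathlib

open MeasureTheory ProbabilityTheory

noncomputable section

/-- The Kolmogorov-Smirnov distance `sup_x |F_P(x) - F_Q(x)|` of two distributions on `ℝ`
(the supremum is over a bounded family, since distribution functions take values in `[0, 1]`). -/
def ksDist (P Q : Measure ℝ) : ℝ := ⨆ x : ℝ, |cdf P x - cdf Q x|

/-- The mutual information `I(U; V) = D(P_{U,V} ‖ P_U ⊗ P_V)`, in nats. -/
def mutualInfo {Ω α β : Type*} [MeasurableSpace Ω] [MeasurableSpace α] [MeasurableSpace β]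
    (μ : Measure Ω) (U : Ω → α) (V : Ω → β) : ENNReal :=
  InformationTheory.klDiv (μ.map (fun ω => (U ω, V ω))) ((μ.map U).prod (μ.map V))

/-- The output `Y_γ = √γ X + Z` of the additive noise channel with input `X` and noise `Z`. -/
def channelOutput {Ω : Type*} (γ : ℝ) (X Z : Ω → ℝ) : Ω → ℝ := fun ω => Real.sqrt γ * X ω + Z ω

/-- The Gaussian channel capacity `C(γ) = (1/2) log (1 + γ)`, in nats. -/
def gaussianCapacity (γ : ℝ) : ℝ := 1 / 2 * Real.log (1 + γ)

end

/-! The capacity gap is itself a divergence. Since Y has second moment 1 + γ, the divergence of the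
joint law from P_X ⊗ N(0, 1 + γ) is exactly C(γ). The golden formula splits it as D(P_Y ‖ N(0, 1 +
γ)) + I(X; Y), so the hypothesis says D(P_Y ‖ N(0, 1 + γ)) ≤ ε (`klDiv_channelOutput_le`).

A small divergence makes the characteristic functions of Y and of the Gaussian uniformly close,
within 2√ε. Both contain the factor of the noise Z; dividing it out gives |φ_X(t) - φ_G(t)| ≤ 2√ε
exp(t²/(2γ)), with G standard normal (`norm_charFun_sub_charFun_gaussianReal_le_exp`). Near 0 the
matching mean and variance give the better bound t².

Esseen's inequality (`ksDist_le_of_charFun`) turns this into a bound on distribution functions: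
smoothing by a Fejér kernel leaves only frequencies |u| ≤ T, and costs a term of order 1/T because
the normal distribution function is Lipschitz. With L = log(γ/(4ε)), the cutoff T = √(γL)/2 holds
the exponential factor below e^{L/8}, while √ε is of order e^{-L/2}. The cost in 1/T is the first
term of the theorem; the frequency integral gives the second. -/

/-! ### Divergence: the golden formula and a total variation bound -/

open InformationTheory in
/-- The Kullback-Leibler divergence is invariant under measurable equivalences. -/
lemma klDiv_map_measurableEquiv {α β : Type*} [MeasurableSpace α] [MeasurableSpace β]
    (μ ν : Measure α) [IsFiniteMeasure μ] [IsFiniteMeasure ν] (e : α ≃ᵐ β) :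
    klDiv (μ.map e) (ν.map e) = klDiv μ ν := by
  refine le_antisymm (klDiv_map_le μ ν e.measurable) ?_
  have h := klDiv_map_le (μ.map e) (ν.map e) e.symm.measurable
  rwa [e.map_symm_map, e.map_symm_map] at h

open InformationTheory in
/-- The golden formula: for every probability measure `ν` on the output space,
`D(P_{U,V} ‖ P_U ⊗ ν) = D(P_V ‖ ν) + I(U; V)`. -/
lemma klDiv_prod_eq_klDiv_add_mutualInfo {Ω α β : Type*} [MeasurableSpace Ω] [MeasurableSpace α]
    [StandardBorelSpace α] [Nonempty α] [MeasurableSpace β] (μ : Measure Ω)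
    [IsProbabilityMeasure μ] {U : Ω → α} {V : Ω → β} (hU : AEMeasurable U μ)
    (hV : AEMeasurable V μ) (ν : Measure β) [IsProbabilityMeasure ν] :
    klDiv (μ.map (fun ω => (U ω, V ω))) ((μ.map U).prod ν)
      = klDiv (μ.map V) ν + mutualInfo μ U V := by
  have := Measure.isProbabilityMeasure_map hU
  have := Measure.isProbabilityMeasure_map hV
  have := Measure.isProbabilityMeasure_map (hU.prodMk hV)
  have := Measure.isProbabilityMeasure_map (hV.prodMk hU)
  have hswap : (μ.map (fun ω => (V ω, U ω))).map (MeasurableEquiv.prodComm (α := β) (β := α))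
      = μ.map (fun ω => (U ω, V ω)) := by
    rw [AEMeasurable.map_map_of_aemeasurable (MeasurableEquiv.measurable _).aemeasurable
      (hV.prodMk hU)]
    rfl
  have hprod (ρ : Measure β) [SFinite ρ] :
      (ρ.prod (μ.map U)).map (MeasurableEquiv.prodComm (α := β) (β := α))
        = (μ.map U).prod ρ := Measure.prod_swap
  -- With V first, the joint law is P_V composed with the conditional law of U, and both product
  -- measures are compositions with the constant kernel P_U. The chain rule then splits off D(P_V ‖
  -- ν).
  rw [mutualInfo, ← hswap, ← hprod ν, ← hprod (μ.map V), klDiv_map_measurableEquiv,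
    klDiv_map_measurableEquiv, ← compProd_map_condDistrib hU, ← Measure.compProd_const,
    ← Measure.compProd_const, klDiv_compProd_eq_add]

open InformationTheory in
/-- The Kullback-Leibler divergence from a positive density. -/
lemma klDiv_withDensity_ofReal {α : Type*} [MeasurableSpace α] {ν : Measure α}
    [IsProbabilityMeasure ν] {f : α → ℝ} (hf : Measurable f) (hpos : ∀ x, 0 < f x)
    [IsProbabilityMeasure (ν.withDensity fun x => ENNReal.ofReal (f x))]
    (hint : Integrable (fun x => Real.log (f x)) (ν.withDensity fun x => ENNReal.ofReal (f x))) :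
    klDiv (ν.withDensity fun x => ENNReal.ofReal (f x)) ν
      = ENNReal.ofReal (∫ x, Real.log (f x) ∂(ν.withDensity fun x => ENNReal.ofReal (f x))) := by
  have hac := withDensity_absolutelyContinuous ν fun x => ENNReal.ofReal (f x)
  have hllr : llr (ν.withDensity fun x => ENNReal.ofReal (f x)) ν
      =ᵐ[ν.withDensity fun x => ENNReal.ofReal (f x)] fun x => Real.log (f x) := by
    filter_upwards [hac.ae_le (Measure.rnDeriv_withDensity ν hf.ennreal_ofReal)] with x hx
    rw [llr, hx, ENNReal.toReal_ofReal (hpos x).le]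
  rw [klDiv_of_ac_of_integrable hac ((integrable_congr hllr).2 hint), integral_congr_ae hllr]
  simp

open InformationTheory in
/-- A total variation bound: integrals of functions bounded by one differ by at most
`2 √D(P ‖ Q)`. -/
lemma norm_integral_sub_integral_le_two_mul_sqrt_klDiv {α : Type*} [MeasurableSpace α]
    {P Q : Measure α} [IsProbabilityMeasure P] [IsProbabilityMeasure Q] (hPQ : klDiv P Q ≠ ⊤)
    {f : α → ℂ} (hf : Measurable f) (hf1 : ∀ x, ‖f x‖ ≤ 1) :
    ‖∫ x, f x ∂P - ∫ x, f x ∂Q‖ ≤ 2 * Real.sqrt (klDiv P Q).toReal := by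
  obtain h0 | hpos := (ENNReal.toReal_nonneg (a := klDiv P Q)).eq_or_lt
  · have : klDiv P Q = 0 := by simpa [ENNReal.toReal_eq_zero_iff, hPQ] using h0.symm
    rw [klDiv_eq_zero_iff.1 this]
    simp
  obtain ⟨hac, hllr⟩ := klDiv_ne_top_iff.1 hPQ
  set r : α → ℝ := fun x => (P.rnDeriv Q x).toReal with hr
  have hrm : Measurable r := (Measure.measurable_rnDeriv P Q).ennreal_toReal
  have hri : Integrable r Q := Measure.integrable_toReal_rnDeriv
  have hr0 : ∀ x, 0 ≤ r x := fun x => ENNReal.toReal_nonneg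
  have hr1 : ∫ x, r x ∂Q = 1 := by
    rw [hr, Measure.integral_toReal_rnDeriv hac]; simp
  have hkl : Integrable (fun x => klFun (r x)) Q := (integrable_klFun_rnDeriv_iff hac).2 hllr
  set D := (klDiv P Q).toReal with hD
  have hDeq : D = ∫ x, klFun (r x) ∂Q := toReal_klDiv_eq_integral_klFun hac
  have hfi : Integrable f Q := (integrable_const (1 : ℝ)).mono' hf.aestronglyMeasurable
    (Filter.Eventually.of_forall hf1)
  have hrfi : Integrable (fun x => r x • f x) Q := by
    refine hri.mono' (hrm.smul hf).aestronglyMeasurable (Filter.Eventually.of_forall fun x => ?_)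
    rw [norm_smul, Real.norm_of_nonneg (hr0 x)]
    exact mul_le_of_le_one_right (hr0 x) (hf1 x)
  -- This weight minimises (2a)⁻¹ D + 2a, the bound obtained after integration; the minimum is 2√D.
  set a := Real.sqrt D / 2 with ha
  have hsq : 0 < Real.sqrt D := Real.sqrt_pos.2 hpos
  have ha0 : 0 < a := by positivity
  have hpt (x : α) : ‖r x • f x - f x‖ ≤ (2 * a)⁻¹ * klFun (r x) + a * (r x + 1) := by
    have h1 : ‖r x • f x - f x‖ ≤ |r x - 1| := by
      have : r x • f x - f x = (r x - 1) • f x := by rw [sub_smul, one_smul]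
      rw [this, norm_smul, Real.norm_eq_abs]
      exact mul_le_of_le_one_right (abs_nonneg _) (hf1 x)
    refine h1.trans ?_
    obtain ⟨s, hs0, hs⟩ : ∃ s, 0 ≤ s ∧ r x = s ^ 2 :=
      ⟨_, Real.sqrt_nonneg (r x), (Real.sq_sqrt (hr0 x)).symm⟩
    -- Squared Hellinger distance is at most the divergence, pointwise. Then |r - 1| = |s - 1|(s +
    -- 1) is split by the weighted arithmetic-geometric inequality.
    have hk : (s - 1) ^ 2 ≤ klFun (r x) := by
      have h2 : klFun (r x) - (s - 1) ^ 2 = 2 * s * klFun s := by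
        rw [hs, klFun_apply, klFun_apply, Real.log_pow]; push_cast; ring
      have := mul_nonneg (mul_nonneg zero_le_two hs0) (klFun_nonneg hs0)
      linarith
    have h3 : |r x - 1| ≤ (2 * a)⁻¹ * (s - 1) ^ 2 + a / 2 * (s + 1) ^ 2 := by
      have : r x - 1 = (s - 1) * (s + 1) := by rw [hs]; ring
      rw [this, abs_mul, ← sq_abs (s - 1), ← sq_abs (s + 1)]
      have h4 : (2 * a)⁻¹ * |s - 1| ^ 2 + a / 2 * |s + 1| ^ 2 - |s - 1| * |s + 1|
          = (2 * a)⁻¹ * (|s - 1| - a * |s + 1|) ^ 2 := by field_simp; ring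
      have : 0 ≤ (2 * a)⁻¹ * (|s - 1| - a * |s + 1|) ^ 2 := by positivity
      linarith
    have h5 : a / 2 * (s + 1) ^ 2 ≤ a * (r x + 1) := by
      rw [hs]; nlinarith [mul_nonneg ha0.le (sq_nonneg (s - 1))]
    have h6 : (2 * a)⁻¹ * (s - 1) ^ 2 ≤ (2 * a)⁻¹ * klFun (r x) := by gcongr
    linarith
  calc ‖∫ x, f x ∂P - ∫ x, f x ∂Q‖ = ‖∫ x, (r x • f x - f x) ∂Q‖ := by
        rw [integral_sub hrfi hfi, hr, integral_rnDeriv_smul hac]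
    _ ≤ ∫ x, ((2 * a)⁻¹ * klFun (r x) + a * (r x + 1)) ∂Q :=
        norm_integral_le_of_norm_le
          ((hkl.const_mul _).add ((hri.add (integrable_const 1)).const_mul _))
          (Filter.Eventually.of_forall hpt)
    _ = (2 * a)⁻¹ * D + a * 2 := by
        have h1 : Integrable (fun x => r x + 1) Q := hri.add (integrable_const 1)
        rw [integral_add (hkl.const_mul _) (h1.const_mul _), integral_const_mul,
          integral_const_mul, integral_add hri (integrable_const 1), hr1, ← hDeq]
        norm_num
    _ = 2 * Real.sqrt D := by
        rw [ha]
        have : D = Real.sqrt D ^ 2 := (Real.sq_sqrt hpos.le).symm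
        nth_rw 2 [this]
        field_simp
        ring

/-! ### The Gaussian channel: from capacity gap to output divergence -/

/-- A law on `ℝ × ℝ` obtained by adding independent standard Gaussian noise to a multiple of the
first coordinate has an explicit density with respect to `P ⊗ N(0, v)`. -/
lemma map_prod_gaussianReal_eq_withDensity (P : Measure ℝ) [IsProbabilityMeasure P] (c : ℝ)
    {v : NNReal} (hv : v ≠ 0) :
    (P.prod (gaussianReal 0 1)).map (fun p => (p.1, c * p.1 + p.2))
      = (P.prod (gaussianReal 0 v)).withDensity fun p => ENNReal.ofReal
          (gaussianPDFReal (c * p.1) 1 p.2 / gaussianPDFReal 0 v p.2) := by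
  have hmeas : Measurable fun p : ℝ × ℝ => ENNReal.ofReal
      (gaussianPDFReal (c * p.1) 1 p.2 / gaussianPDFReal 0 v p.2) := by
    unfold gaussianPDFReal; fun_prop
  refine Measure.ext_of_lintegral _ fun g hg => ?_
  rw [lintegral_map hg (by fun_prop), lintegral_prod _ (by fun_prop),
    lintegral_withDensity_eq_lintegral_mul _ hmeas hg, lintegral_prod _ (by fun_prop)]
  refine lintegral_congr fun x => ?_
  calc ∫⁻ z, g (x, c * x + z) ∂(gaussianReal 0 1)
      = ∫⁻ y, g (x, y) ∂((gaussianReal 0 1).map (fun z => c * x + z)) := by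
        rw [lintegral_map (by fun_prop) (by fun_prop)]
    _ = ∫⁻ y, gaussianPDF (c * x) 1 y * g (x, y) := by
        rw [gaussianReal_map_const_add, zero_add, gaussianReal_of_var_ne_zero _ one_ne_zero,
          lintegral_withDensity_eq_lintegral_mul _ (measurable_gaussianPDF _ _) (by fun_prop)]
        rfl
    _ = _ := by
        rw [gaussianReal_of_var_ne_zero _ hv,
          lintegral_withDensity_eq_lintegral_mul _ (measurable_gaussianPDF _ _)
            (by fun_prop)]
        refine lintegral_congr fun y => ?_
        simp only [Pi.mul_apply]
        rw [← mul_assoc, gaussianPDF, gaussianPDF, ← ENNReal.ofReal_mul (gaussianPDFReal_nonneg _ _ _),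
          mul_div_cancel₀ _ (gaussianPDFReal_pos 0 v y hv).ne']

lemma log_gaussianPDFReal_div (m x : ℝ) {v : NNReal} (hv : v ≠ 0) :
    Real.log (gaussianPDFReal m 1 x / gaussianPDFReal 0 v x)
      = 1 / 2 * Real.log v - (x - m) ^ 2 / 2 + x ^ 2 / (2 * v) := by
  have hv' : (0 : ℝ) < v := by positivity
  have hlog (m : ℝ) (w : NNReal) (hw : (0 : ℝ) < w) : Real.log (gaussianPDFReal m w x)
      = -(1 / 2 * (Real.log (2 * Real.pi) + Real.log w)) - (x - m) ^ 2 / (2 * w) := by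
    rw [gaussianPDFReal, Real.log_mul (by positivity) (Real.exp_ne_zero _), Real.log_exp,
      Real.log_inv, Real.log_sqrt (by positivity), Real.log_mul (by positivity) hw.ne']
    ring
  rw [Real.log_div (gaussianPDFReal_pos _ _ _ one_ne_zero).ne' (gaussianPDFReal_pos _ _ _ hv).ne',
    hlog _ _ (by simp), hlog _ _ hv']
  simp
  ring

section Channel

variable {Ω : Type*} [MeasurableSpace Ω] {μ : Measure Ω} {X Z : Ω → ℝ}

lemma aemeasurable_channelOutput (γ : ℝ) (hX : AEMeasurable X μ) (hZ : AEMeasurable Z μ) :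
    AEMeasurable (channelOutput γ X Z) μ :=
  (hX.const_mul _).add hZ

lemma integral_sq_of_hasLaw_gaussianReal (hZ : HasLaw Z (gaussianReal 0 1) μ) :
    ∫ ω, Z ω ^ 2 ∂μ = 1 := by
  have h : ∫ x, x ^ 2 ∂(gaussianReal 0 1) = 1 := by
    have h1 := variance_fun_id_gaussianReal (μ := 0) (v := 1)
    rw [variance_of_integral_eq_zero (X := fun x => x) aemeasurable_id' (by simp)] at h1
    simpa using h1
  rw [← h, ← hZ.map_eq, integral_map hZ.aemeasurable (by fun_prop)]

lemma memLp_two_of_hasLaw_gaussianReal (hZ : HasLaw Z (gaussianReal 0 1) μ) : MemLp Z 2 μ := by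
  have h := memLp_id_gaussianReal (μ := 0) (v := 1) 2
  rw [← hZ.map_eq] at h
  exact (memLp_map_measure_iff (by fun_prop) hZ.aemeasurable).1 h

/-- Output power of the additive Gaussian noise channel. -/
lemma integral_sq_channelOutput (hX : AEMeasurable X μ) (hvar : ∫ ω, X ω ^ 2 ∂μ = 1)
    (hZ : HasLaw Z (gaussianReal 0 1) μ) (hXZ : IndepFun X Z μ) {γ : ℝ} (hγ : 0 ≤ γ) :
    Integrable (fun ω => channelOutput γ X Z ω ^ 2) μ ∧
      ∫ ω, channelOutput γ X Z ω ^ 2 ∂μ = 1 + γ := by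
  -- A non-integrable function has integral 0 by convention, so the value 1 forces integrability.
  have hX2 : Integrable (fun ω => X ω ^ 2) μ := by
    by_contra h; rw [integral_undef h] at hvar; norm_num at hvar
  have hXL : MemLp X 2 μ := (memLp_two_iff_integrable_sq hX.aestronglyMeasurable).2 hX2
  have hZL := memLp_two_of_hasLaw_gaussianReal hZ
  have hXZi : Integrable (fun ω => X ω * Z ω) μ := hXL.integrable_mul hZL
  have hZ0 : ∫ ω, Z ω ∂μ = 0 := by
    have := hZ.integral_eq
    simpa using this
  have heq : (fun ω => channelOutput γ X Z ω ^ 2)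
      = fun ω => γ * X ω ^ 2 + 2 * Real.sqrt γ * (X ω * Z ω) + Z ω ^ 2 := by
    ext ω
    rw [channelOutput]
    nth_rw 2 [← Real.sq_sqrt hγ]
    ring
  have h1 : Integrable (fun ω => γ * X ω ^ 2 + 2 * Real.sqrt γ * (X ω * Z ω)) μ :=
    (hX2.const_mul _).add (hXZi.const_mul _)
  rw [heq]
  refine ⟨h1.add hZL.integrable_sq, ?_⟩
  rw [integral_add h1 hZL.integrable_sq, integral_add (hX2.const_mul _) (hXZi.const_mul _),
    integral_const_mul, integral_const_mul, hvar, integral_sq_of_hasLaw_gaussianReal hZ,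
    hXZ.integral_fun_mul_eq_mul_integral hX.aestronglyMeasurable
      hZ.aemeasurable.aestronglyMeasurable, hZ0]
  ring

variable [IsProbabilityMeasure μ]

open InformationTheory in
/-- The capacity is the divergence of the joint law from the product of the input law and the
capacity-achieving output law. -/
lemma klDiv_channel_eq_gaussianCapacity (hX : AEMeasurable X μ) (hvar : ∫ ω, X ω ^ 2 ∂μ = 1)
    (hZ : HasLaw Z (gaussianReal 0 1) μ) (hXZ : IndepFun X Z μ) {γ : ℝ} (hγ : 0 ≤ γ) :
    klDiv (μ.map (fun ω => (X ω, channelOutput γ X Z ω)))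
        ((μ.map X).prod (gaussianReal 0 (1 + γ).toNNReal))
      = ENNReal.ofReal (gaussianCapacity γ) := by
  have := Measure.isProbabilityMeasure_map hX
  have hv : (1 + γ).toNNReal ≠ 0 := by
    rw [Ne, Real.toNNReal_eq_zero]; linarith
  have hvr : ((1 + γ).toNNReal : ℝ) = 1 + γ := Real.coe_toNNReal _ (by linarith)
  have hY := aemeasurable_channelOutput γ hX hZ.aemeasurable
  have hmap : μ.map (fun ω => (X ω, channelOutput γ X Z ω))
      = ((μ.map X).prod (gaussianReal 0 (1 + γ).toNNReal)).withDensity fun p => ENNReal.ofReal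
          (gaussianPDFReal (Real.sqrt γ * p.1) 1 p.2
            / gaussianPDFReal 0 (1 + γ).toNNReal p.2) := by
    rw [← map_prod_gaussianReal_eq_withDensity _ _ hv, ← hZ.map_eq,
      ← (indepFun_iff_map_prod_eq_prod_map_map hX hZ.aemeasurable).1 hXZ,
      AEMeasurable.map_map_of_aemeasurable (by fun_prop) (hX.prodMk hZ.aemeasurable)]
    rfl
  have hprob : IsProbabilityMeasure (μ.map (fun ω => (X ω, channelOutput γ X Z ω))) :=
    Measure.isProbabilityMeasure_map (hX.prodMk hY)
  obtain ⟨hY2, hYi⟩ := integral_sq_channelOutput hX hvar hZ hXZ hγ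
  have hZ2 := (memLp_two_of_hasLaw_gaussianReal hZ).integrable_sq
  have hdm : Measurable fun p : ℝ × ℝ => gaussianPDFReal (Real.sqrt γ * p.1) 1 p.2
      / gaussianPDFReal 0 (1 + γ).toNNReal p.2 := by
    unfold gaussianPDFReal; fun_prop
  -- Along the channel Y - √γ X = Z. The two quadratic terms have means -1/2 and 1/2 and cancel,
  -- leaving the capacity.
  have hlog (ω : Ω) : Real.log (gaussianPDFReal (Real.sqrt γ * X ω) 1 (channelOutput γ X Z ω)
      / gaussianPDFReal 0 (1 + γ).toNNReal (channelOutput γ X Z ω))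
      = 1 / 2 * Real.log (1 + γ) - Z ω ^ 2 / 2 + channelOutput γ X Z ω ^ 2 / (2 * (1 + γ)) := by
    rw [log_gaussianPDFReal_div _ _ hv, hvr]
    simp [channelOutput]
  have h1 : Integrable (fun ω => 1 / 2 * Real.log (1 + γ) - Z ω ^ 2 / 2) μ :=
    (integrable_const _).sub (hZ2.div_const _)
  have hlogi : Integrable (fun ω => 1 / 2 * Real.log (1 + γ) - Z ω ^ 2 / 2
      + channelOutput γ X Z ω ^ 2 / (2 * (1 + γ))) μ :=
    h1.add (hY2.div_const _)
  rw [hmap] at hprob ⊢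
  rw [klDiv_withDensity_ofReal hdm fun p => div_pos (gaussianPDFReal_pos _ _ _ one_ne_zero)
    (gaussianPDFReal_pos _ _ _ hv)]
  · rw [← hmap, integral_map (hX.prodMk hY) hdm.log.aestronglyMeasurable]
    simp_rw [hlog]
    congr 1
    rw [integral_add h1 (hY2.div_const _),
      integral_sub (integrable_const _) (hZ2.div_const _), integral_div, integral_div, hYi,
      integral_sq_of_hasLaw_gaussianReal hZ, gaussianCapacity]
    have : 1 + γ ≠ 0 := by linarith
    simp
    field_simp
    ring
  · rw [← hmap, integrable_map_measure hdm.log.aestronglyMeasurable (hX.prodMk hY)]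
    refine hlogi.congr (Filter.Eventually.of_forall fun ω => ?_)
    simp only [Function.comp_apply]
    rw [hlog]

open InformationTheory in
/-- The capacity gap bounds the divergence of the output law from the capacity-achieving one. -/
lemma klDiv_channelOutput_le (hX : AEMeasurable X μ) (hvar : ∫ ω, X ω ^ 2 ∂μ = 1)
    (hZ : HasLaw Z (gaussianReal 0 1) μ) (hXZ : IndepFun X Z μ) {γ ε : ℝ} (hγ : 0 ≤ γ)
    (hcap : (gaussianCapacity γ : EReal) - (mutualInfo μ X (channelOutput γ X Z) : EReal)
      ≤ (ε : EReal)) :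
    klDiv (μ.map (channelOutput γ X Z)) (gaussianReal 0 (1 + γ).toNNReal) ≠ ⊤ ∧
      (klDiv (μ.map (channelOutput γ X Z)) (gaussianReal 0 (1 + γ).toNNReal)).toReal ≤ ε := by
  have h := klDiv_prod_eq_klDiv_add_mutualInfo μ hX (aemeasurable_channelOutput γ hX hZ.aemeasurable)
    (gaussianReal 0 (1 + γ).toNNReal)
  rw [klDiv_channel_eq_gaussianCapacity hX hvar hZ hXZ hγ] at h
  have hC : 0 ≤ gaussianCapacity γ :=
    mul_nonneg (by norm_num) (Real.log_nonneg (by linarith))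
  -- The capacity is finite, hence so are both summands, and the extended inequality reduces to a
  -- real one.
  have htop : klDiv (μ.map (channelOutput γ X Z)) (gaussianReal 0 (1 + γ).toNNReal)
      + mutualInfo μ X (channelOutput γ X Z) ≠ ⊤ := h ▸ ENNReal.ofReal_ne_top
  obtain ⟨hD, hI⟩ := ENNReal.add_ne_top.1 htop
  refine ⟨hD, ?_⟩
  have hr := congrArg ENNReal.toReal h
  rw [ENNReal.toReal_ofReal hC, ENNReal.toReal_add hD hI] at hr
  rw [← EReal.coe_ennreal_toReal hI, ← EReal.coe_sub, EReal.coe_le_coe_iff] at hcap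
  linarith

end Channel

/-! ### Characteristic function bounds, and the integral that combines them -/

/-- For x ≥ 0 the derivative has norm |e^{is} - 1| ≤ s, which integrates to x²/2; complex
conjugation handles x ≤ 0. -/
lemma norm_cexp_mul_I_sub_one_sub_le (x : ℝ) :
    ‖Complex.exp (x * Complex.I) - 1 - x * Complex.I‖ ≤ x ^ 2 / 2 := by
  have hpos (x : ℝ) (hx : 0 ≤ x) :
      ‖Complex.exp (x * Complex.I) - 1 - x * Complex.I‖ ≤ x ^ 2 / 2 := by
    have hd (s : ℝ) : HasDerivAt (fun t : ℝ => Complex.exp (t * Complex.I) - 1 - t * Complex.I)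
        ((Complex.exp (s * Complex.I) - 1) * Complex.I) s := by
      have h1 : HasDerivAt (fun t : ℝ => (t : ℂ) * Complex.I) Complex.I s := by
        simpa using (Complex.ofRealCLM.hasDerivAt (x := s)).mul_const Complex.I
      convert! (h1.cexp.sub_const 1).sub h1 using 1
      ring
    have hB (s : ℝ) : HasDerivAt (fun t : ℝ => t ^ 2 / 2) s s := by
      simpa using (hasDerivAt_pow 2 s).div_const 2
    refine image_norm_le_of_norm_deriv_right_le_deriv_boundary (a := 0) (b := x)
      (f := fun t : ℝ => Complex.exp (t * Complex.I) - 1 - t * Complex.I)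
      (B := fun t : ℝ => t ^ 2 / 2) (B' := fun t => t)
      (fun s _ => (hd s).continuousAt.continuousWithinAt)
      (fun s _ => (hd s).hasDerivWithinAt) (by simp) hB (fun s hs => ?_)
      (Set.right_mem_Icc.2 hx)
    rw [norm_mul, Complex.norm_I, mul_one, mul_comm]
    simpa [abs_of_nonneg hs.1] using Real.norm_exp_I_mul_ofReal_sub_one_le (x := s)
  obtain hx | hx := le_total 0 x
  · exact hpos x hx
  · have h := hpos (-x) (by linarith)
    rw [← Complex.norm_conj, neg_sq] at h
    convert! h using 2
    simp [← Complex.exp_conj]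
    ring

section Moments

variable {Ω : Type*} [MeasurableSpace Ω] {μ : Measure Ω} [IsProbabilityMeasure μ] {X Z : Ω → ℝ}

/-- The characteristic function of a centered law with unit variance is quadratically close to
one. -/
lemma norm_charFun_sub_one_le (hX : AEMeasurable X μ) (hmean : ∫ ω, X ω ∂μ = 0)
    (hvar : ∫ ω, X ω ^ 2 ∂μ = 1) (t : ℝ) : ‖charFun (μ.map X) t - 1‖ ≤ t ^ 2 / 2 := by
  have hX2 : Integrable (fun ω => X ω ^ 2) μ := by
    by_contra h; rw [integral_undef h] at hvar; norm_num at hvar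
  have hX1 : Integrable X μ :=
    ((memLp_two_iff_integrable_sq hX.aestronglyMeasurable).2 hX2).integrable one_le_two
  have hexp : Integrable (fun ω => Complex.exp ((t * X ω : ℝ) * Complex.I)) μ := by
    refine (integrable_const (1 : ℝ)).mono' ?_ (Filter.Eventually.of_forall fun ω => ?_)
    · exact (Measurable.comp_aemeasurable (g := fun x : ℝ => Complex.exp ((t * x : ℝ) * Complex.I))
        (by fun_prop) hX).aestronglyMeasurable
    · rw [Complex.norm_exp_ofReal_mul_I]
  have hlin : Integrable (fun ω => ((t * X ω : ℝ) : ℂ) * Complex.I) μ :=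
    ((hX1.const_mul t).ofReal (𝕜 := ℂ)).mul_const Complex.I
  have h1 : Integrable (fun ω => Complex.exp ((t * X ω : ℝ) * Complex.I) - 1) μ :=
    hexp.sub (integrable_const 1)
  -- The linear Taylor term has mean zero, so subtracting it changes nothing.
  have heq : charFun (μ.map X) t - 1
      = ∫ ω, (Complex.exp ((t * X ω : ℝ) * Complex.I) - 1 - (t * X ω : ℝ) * Complex.I) ∂μ := by
    rw [integral_sub h1 hlin, integral_sub hexp (integrable_const 1),
      integral_mul_const, integral_complex_ofReal, integral_const_mul, hmean, charFun_apply_real,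
      integral_map hX (by fun_prop)]
    simp
  rw [heq]
  refine (norm_integral_le_of_norm_le ((hX2.const_mul (t ^ 2)).div_const 2)
    (Filter.Eventually.of_forall fun ω => ?_)).trans_eq ?_
  · refine (norm_cexp_mul_I_sub_one_sub_le _).trans_eq ?_
    ring
  · rw [integral_div, integral_const_mul, hvar, mul_one]

/-- Each characteristic function is within t²/2 of 1. This is what makes the difference divided by
|t| integrable at 0. -/
lemma norm_charFun_sub_charFun_gaussianReal_le_sq (hX : AEMeasurable X μ)
    (hmean : ∫ ω, X ω ∂μ = 0) (hvar : ∫ ω, X ω ^ 2 ∂μ = 1) (t : ℝ) :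
    ‖charFun (μ.map X) t - charFun (gaussianReal 0 1) t‖ ≤ t ^ 2 := by
  have h1 := norm_charFun_sub_one_le hX hmean hvar t
  have h2 := norm_charFun_sub_one_le (μ := gaussianReal 0 1) (X := fun x => x)
    aemeasurable_id' (by simp) (integral_sq_of_hasLaw_gaussianReal HasLaw.id) t
  rw [Measure.map_id'] at h2
  calc ‖charFun (μ.map X) t - charFun (gaussianReal 0 1) t‖
      = ‖(charFun (μ.map X) t - 1) - (charFun (gaussianReal 0 1) t - 1)‖ := by congr 1; ring
    _ ≤ _ := norm_sub_le _ _
    _ ≤ t ^ 2 := by linarith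

open InformationTheory in
/-- Deconvolution: closeness of the output law to a Gaussian in divergence bounds the difference of
the characteristic functions of the inputs. -/
lemma norm_charFun_sub_charFun_gaussianReal_le_exp (hX : AEMeasurable X μ)
    (hZ : HasLaw Z (gaussianReal 0 1) μ) (hXZ : IndepFun X Z μ) {γ : ℝ} (hγ : 0 < γ)
    (hD : klDiv (μ.map (channelOutput γ X Z)) (gaussianReal 0 (1 + γ).toNNReal) ≠ ⊤) (t : ℝ) :
    ‖charFun (μ.map X) t - charFun (gaussianReal 0 1) t‖
      ≤ Real.exp (t ^ 2 / (2 * γ)) * (2 * Real.sqrt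
        (klDiv (μ.map (channelOutput γ X Z)) (gaussianReal 0 (1 + γ).toNNReal)).toReal) := by
  have hprob := Measure.isProbabilityMeasure_map
    (aemeasurable_channelOutput γ hX hZ.aemeasurable)
  have hs : Real.sqrt γ ≠ 0 := (Real.sqrt_pos.2 hγ).ne'
  -- At this frequency √γ X contributes φ_X(t) and the noise contributes exp(-t²/(2γ)). N(0, 1 + γ)
  -- factors the same way, as the output for a standard normal input.
  set u := t / Real.sqrt γ with hu
  have hu2 : u ^ 2 = t ^ 2 / γ := by rw [hu, div_pow, Real.sq_sqrt hγ.le]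
  have hbound := norm_integral_sub_integral_le_two_mul_sqrt_klDiv hD
    (f := fun x => Complex.exp (u * x * Complex.I)) (by fun_prop)
    (fun x => by rw [← Complex.ofReal_mul, Complex.norm_exp_ofReal_mul_I])
  rw [← charFun_apply_real, ← charFun_apply_real] at hbound
  have hY : charFun (μ.map (channelOutput γ X Z)) u
      = charFun (μ.map X) t * Real.exp (-(t ^ 2 / (2 * γ))) := by
    have h := congrFun ((hXZ.comp (measurable_const_mul (Real.sqrt γ)) measurable_id
      ).charFun_map_fun_add_eq_mul (hX.const_mul _) hZ.aemeasurable) u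
    change charFun (μ.map fun ω => Real.sqrt γ * X ω + Z ω) u = _
    rw [h, Pi.mul_apply, charFun_map_mul_comp hX, hu, mul_div_cancel₀ _ hs, hZ.map_eq,
      charFun_gaussianReal, ← hu, Complex.ofReal_exp]
    congr 2
    rw [show t ^ 2 / (2 * γ) = u ^ 2 / 2 by rw [hu2]; field_simp]
    simp
  have hG : charFun (gaussianReal 0 (1 + γ).toNNReal) u
      = charFun (gaussianReal 0 1) t * Real.exp (-(t ^ 2 / (2 * γ))) := by
    rw [charFun_gaussianReal, charFun_gaussianReal, Complex.ofReal_exp, ← Complex.exp_add,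
      Real.coe_toNNReal _ (by linarith)]
    congr 1
    have : (u : ℂ) ^ 2 = t ^ 2 / γ := by exact_mod_cast hu2
    rw [this]
    have : (γ : ℂ) ≠ 0 := by exact_mod_cast hγ.ne'
    push_cast
    field_simp
    ring
  rw [hY, hG, ← sub_mul, norm_mul, Complex.norm_real, Real.norm_of_nonneg (Real.exp_nonneg _),
    Real.exp_neg, ← div_eq_mul_inv, div_le_iff₀ (Real.exp_pos _)] at hbound
  linarith

end Moments

/-- The integral of the harmonic mean of `|u|` and `B / |u|`. -/
lemma integral_two_mul_abs_div_add_sq {B T : ℝ} (hB : 0 < B) (hT : 0 ≤ T) :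
    ∫ u in -T..T, 2 * B * |u| / (B + u ^ 2) = 2 * B * Real.log (1 + T ^ 2 / B) := by
  have hne (u : ℝ) : B + u ^ 2 ≠ 0 := by positivity
  have hcont : Continuous fun u : ℝ => 2 * B * |u| / (B + u ^ 2) :=
    Continuous.div (by fun_prop) (by fun_prop) hne
  have hhalf : ∫ u in (0 : ℝ)..T, 2 * B * |u| / (B + u ^ 2)
      = B * Real.log (1 + T ^ 2 / B) := by
    have hd (u : ℝ) (hu : u ∈ Set.uIcc 0 T) : HasDerivAt (fun u : ℝ => B * Real.log (B + u ^ 2))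
        (2 * B * |u| / (B + u ^ 2)) u := by
      rw [Set.uIcc_of_le hT] at hu
      convert! (((hasDerivAt_pow 2 u).const_add B).log (hne u)).const_mul B using 1
      rw [abs_of_nonneg hu.1]
      simp
      ring
    rw [intervalIntegral.integral_eq_sub_of_hasDerivAt hd (hcont.intervalIntegrable _ _),
      ← mul_sub, ← Real.log_div (hne _) (hne _)]
    congr 2
    field_simp
    ring
  have hneg : ∫ u in -T..0, 2 * B * |u| / (B + u ^ 2)
      = ∫ u in (0 : ℝ)..T, 2 * B * |u| / (B + u ^ 2) := by
    have := intervalIntegral.integral_comp_neg (a := 0) (b := T)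
      fun u : ℝ => 2 * B * |u| / (B + u ^ 2)
    simpa using this.symm
  rw [← intervalIntegral.integral_add_adjacent_intervals (hcont.intervalIntegrable (-T) 0)
    (hcont.intervalIntegrable 0 T), hneg, hhalf]
  ring

/-! ### The Fejér kernel -/

/-- The Fejér kernel, the probability density whose characteristic function is the triangle
`u ↦ max 0 (1 - |u| / T)`. -/
noncomputable def fejerKernel (T x : ℝ) : ℝ := T / (2 * Real.pi) * Real.sinc (T * x / 2) ^ 2

lemma continuous_fejerKernel (T : ℝ) : Continuous (fejerKernel T) := by
  unfold fejerKernel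
  have := Real.continuous_sinc
  fun_prop

lemma fejerKernel_nonneg {T : ℝ} (hT : 0 ≤ T) (x : ℝ) : 0 ≤ fejerKernel T x := by
  unfold fejerKernel; positivity

lemma fejerKernel_neg (T x : ℝ) : fejerKernel T (-x) = fejerKernel T x := by
  simp [fejerKernel, neg_div, Real.sinc_neg]

lemma fejerKernel_of_ne_zero {T x : ℝ} (hT : T ≠ 0) (hx : x ≠ 0) :
    fejerKernel T x = (1 - Real.cos (T * x)) / (Real.pi * T * x ^ 2) := by
  have h : Real.cos (T * x) = 1 - 2 * Real.sin (T * x / 2) ^ 2 := by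
    rw [show T * x = 2 * (T * x / 2) by ring, Real.cos_two_mul, Real.cos_sq']
    ring_nf
  rw [fejerKernel, Real.sinc_of_ne_zero (by positivity), h]
  field_simp
  ring

lemma fejerKernel_le {T x : ℝ} (hT : 0 < T) (hx : x ≠ 0) :
    fejerKernel T x ≤ 2 / (Real.pi * T) * x ^ (-2 : ℤ) := by
  rw [fejerKernel_of_ne_zero hT.ne' hx, zpow_neg, ← div_eq_mul_inv, div_div]
  have : 0 < Real.pi * T * x ^ 2 := by positivity
  exact div_le_div_of_nonneg_right (by linarith [Real.neg_one_le_cos (T * x)]) this.le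

lemma integral_one_sub_div_mul_cos {T : ℝ} (hT : 0 < T) (x : ℝ) :
    ∫ u in (0 : ℝ)..T, (1 - u / T) * Real.cos (u * x) = Real.pi * fejerKernel T x := by
  obtain rfl | hx := eq_or_ne x 0
  · simp [fejerKernel]
    field_simp
    ring
  have hd (u : ℝ) : HasDerivAt
      (fun u => (1 - u / T) * (Real.sin (u * x) / x) - Real.cos (u * x) / (T * x ^ 2))
      ((1 - u / T) * Real.cos (u * x)) u := by
    have h0 : HasDerivAt (fun u => u * x) x u := by simpa using (hasDerivAt_id u).mul_const x
    have h1 : HasDerivAt (fun u => 1 - u / T) (-(1 / T)) u := by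
      simpa using ((hasDerivAt_id u).div_const T).const_sub 1
    convert! (h1.mul (h0.sin.div_const x)).sub (h0.cos.div_const (T * x ^ 2)) using 1
    field_simp
    ring
  rw [intervalIntegral.integral_eq_sub_of_hasDerivAt (fun u _ => hd u)
    (Continuous.intervalIntegrable (by fun_prop) _ _), fejerKernel_of_ne_zero hT.ne' hx]
  have := hT.ne'
  simp
  field_simp
  ring

/-- The Fejér kernel is the inverse Fourier transform of the triangle function. -/
lemma integral_triangle_mul_cexp {T : ℝ} (hT : 0 < T) (x : ℝ) :
    ∫ u in -T..T, ((1 - |u| / T : ℝ) : ℂ) * Complex.exp (u * x * Complex.I)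
      = 2 * Real.pi * fejerKernel T x := by
  have hc : Continuous fun u : ℝ => ((1 - |u| / T : ℝ) : ℂ) * Complex.exp (u * x * Complex.I) := by
    fun_prop
  have hneg : ∫ u in -T..0, ((1 - |u| / T : ℝ) : ℂ) * Complex.exp (u * x * Complex.I)
      = ∫ u in (0 : ℝ)..T, ((1 - |u| / T : ℝ) : ℂ) * Complex.exp (-(u * x * Complex.I)) := by
    have := intervalIntegral.integral_comp_neg (a := 0) (b := T)
      fun u : ℝ => ((1 - |u| / T : ℝ) : ℂ) * Complex.exp (u * x * Complex.I)
    simpa using this.symm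
  rw [← intervalIntegral.integral_add_adjacent_intervals (hc.intervalIntegrable (-T) 0)
    (hc.intervalIntegrable 0 T), hneg, ← intervalIntegral.integral_add
    (Continuous.intervalIntegrable (by fun_prop) _ _) (hc.intervalIntegrable 0 T), mul_assoc,
    ← Complex.ofReal_mul, ← integral_one_sub_div_mul_cos hT, ← intervalIntegral.integral_ofReal,
    ← intervalIntegral.integral_const_mul]
  refine intervalIntegral.integral_congr fun u hu => ?_
  rw [Set.uIcc_of_le hT.le] at hu
  simp only [abs_of_nonneg hu.1]
  push_cast
  rw [Complex.cos]
  ring_nf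

lemma integrable_sinc_sq : Integrable fun x : ℝ => Real.sinc x ^ 2 := by
  have hc := Real.continuous_sinc
  refine (integrable_inv_one_add_sq.const_mul 2).mono'
    (Continuous.aestronglyMeasurable (by fun_prop)) (Filter.Eventually.of_forall fun x => ?_)
  rw [Real.norm_of_nonneg (sq_nonneg _), ← div_eq_mul_inv, le_div_iff₀ (by positivity)]
  have h1 : Real.sinc x ^ 2 ≤ 1 := (sq_le_one_iff_abs_le_one _).2
    (abs_le.2 ⟨Real.neg_one_le_sinc x, Real.sinc_le_one x⟩)
  have h2 : Real.sinc x ^ 2 * x ^ 2 ≤ 1 := by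
    obtain rfl | hx := eq_or_ne x 0
    · simp
    · rw [Real.sinc_of_ne_zero hx, div_pow, div_mul_cancel₀ _ (by positivity)]
      exact Real.sin_sq_le_one x
  linarith

lemma integrable_fejerKernel {T : ℝ} (hT : 0 < T) : Integrable (fejerKernel T) := by
  have h := (integrable_sinc_sq.comp_mul_left' (R := T / 2) (by positivity)).const_mul
    (T / (2 * Real.pi))
  refine h.congr (Filter.Eventually.of_forall fun x => ?_)
  simp only [fejerKernel]
  ring_nf

-- The triangle function has transform sinc²(πw), which is integrable, so Fourier inversion at 0
-- equates the integral of sinc²(πw) with the triangle's height 1. Rescaling gives every T.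
open FourierTransform in
lemma integral_fejerKernel {T : ℝ} (hT : 0 < T) : ∫ x, fejerKernel T x = 1 := by
  set f : ℝ → ℂ := fun v => ((max 0 (1 - |v|) : ℝ) : ℂ) with hf
  have hfc : Continuous f := by fun_prop
  have hzero (v : ℝ) (hv : v ∉ Set.Ioc (-1) 1) : f v = 0 := by
    rw [hf]
    simp only [Complex.ofReal_eq_zero, max_eq_left_iff, sub_nonpos]
    rw [Set.mem_Ioc, not_and_or, not_lt, not_le] at hv
    rw [le_abs]
    rcases hv with h | h
    · exact Or.inr (by linarith)
    · exact Or.inl h.le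
  have hfi : Integrable f := hfc.integrable_of_hasCompactSupport
    (HasCompactSupport.intro (isCompact_Icc (a := -1) (b := 1))
      fun v hv => hzero v fun h => hv (Set.Ioc_subset_Icc_self h))
  have hF : 𝓕 f = fun w => ((Real.sinc (Real.pi * w) ^ 2 : ℝ) : ℂ) := by
    ext w
    rw [Real.fourier_real_eq_integral_exp_smul,
      ← setIntegral_eq_integral_of_forall_compl_eq_zero (s := Set.Ioc (-1) 1)
        (fun v hv => by rw [hzero v hv, smul_zero]),
      ← intervalIntegral.integral_of_le (by norm_num)]
    have h := integral_triangle_mul_cexp one_pos (-(2 * Real.pi * w))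
    rw [fejerKernel_neg, fejerKernel] at h
    calc _ = ∫ u in (-1 : ℝ)..1, ((1 - |u| / 1 : ℝ) : ℂ)
          * Complex.exp (u * (-(2 * Real.pi * w) : ℝ) * Complex.I) := by
          refine intervalIntegral.integral_congr fun u hu => ?_
          rw [Set.uIcc_of_le (by norm_num)] at hu
          have : 0 ≤ 1 - |u| := sub_nonneg.2 (abs_le.2 hu)
          simp only [hf, max_eq_right this, smul_eq_mul, div_one]
          rw [mul_comm]
          congr 2
          push_cast
          ring
      _ = _ := by
          rw [h, show (1 : ℝ) * (2 * Real.pi * w) / 2 = Real.pi * w by ring]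
          have : (Real.pi : ℂ) ≠ 0 := by exact_mod_cast Real.pi_ne_zero
          push_cast
          field_simp
  have hFi : Integrable (𝓕 f) := by
    rw [hF]
    exact (integrable_sinc_sq.comp_mul_left' Real.pi_ne_zero).ofReal
  have hinv := congrFun (hfc.fourierInv_fourier_eq hfi hFi) 0
  rw [Real.fourierInv_eq', hF] at hinv
  simp only [inner_zero_right, mul_zero, Complex.ofReal_zero, zero_mul, Complex.exp_zero,
    one_smul] at hinv
  rw [integral_complex_ofReal] at hinv
  have h1 : ∫ w, Real.sinc (Real.pi * w) ^ 2 = 1 := by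
    simpa [hf] using hinv
  have h2 := Measure.integral_comp_mul_left (fun w => Real.sinc (Real.pi * w) ^ 2)
    (T / (2 * Real.pi))
  have hpos : 0 < T / (2 * Real.pi) := by positivity
  rw [h1, abs_of_pos (inv_pos.2 hpos), smul_eq_mul, mul_one] at h2
  calc ∫ x, fejerKernel T x
      = ∫ x, T / (2 * Real.pi) * Real.sinc (Real.pi * (T / (2 * Real.pi) * x)) ^ 2 := by
        refine integral_congr_ae (Filter.Eventually.of_forall fun x => ?_)
        simp only [fejerKernel]
        rw [show T * x / 2 = Real.pi * (T / (2 * Real.pi) * x) by field_simp]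
    _ = 1 := by rw [integral_const_mul, h2, mul_inv_cancel₀ hpos.ne']

/-- Tail bound for the Fejér kernel. -/
lemma setIntegral_compl_Ioo_fejerKernel_le {T δ : ℝ} (hT : 0 < T) (hδ : 0 < δ) :
    ∫ x in (Set.Ioo (-δ) δ)ᶜ, fejerKernel T x ≤ 4 / (Real.pi * T * δ) := by
  have hi := integrable_fejerKernel hT
  have hcompl : (Set.Ioo (-δ) δ)ᶜ = Set.Iic (-δ) ∪ Set.Ici δ := by
    ext x; simp [Set.mem_Ioo]; grind
  have hright : ∫ x in Set.Ioi δ, fejerKernel T x ≤ 2 / (Real.pi * T * δ) := by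
    have hint : IntegrableOn (fun x : ℝ => 2 / (Real.pi * T) * x ^ (-2 : ℝ)) (Set.Ioi δ) :=
      (integrableOn_Ioi_rpow_of_lt (by norm_num) hδ).const_mul _
    calc ∫ x in Set.Ioi δ, fejerKernel T x
        ≤ ∫ x in Set.Ioi δ, 2 / (Real.pi * T) * x ^ (-2 : ℝ) := by
          refine setIntegral_mono_on hi.integrableOn hint measurableSet_Ioi fun x hx => ?_
          have hx0 : x ≠ 0 := (hδ.trans hx).ne'
          refine (fejerKernel_le hT hx0).trans_eq ?_
          rw [← Real.rpow_intCast]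
          norm_num
      _ = 2 / (Real.pi * T * δ) := by
          rw [integral_const_mul, integral_Ioi_rpow_of_lt (by norm_num) hδ]
          norm_num [Real.rpow_neg_one]
          field_simp
  have hleft : ∫ x in Set.Iic (-δ), fejerKernel T x = ∫ x in Set.Ioi δ, fejerKernel T x := by
    rw [← integral_comp_neg_Ioi]
    simp_rw [fejerKernel_neg]
  rw [hcompl, setIntegral_union (by
      rw [Set.disjoint_left]; intro x hx hx'; simp only [Set.mem_Iic, Set.mem_Ici] at hx hx'
      linarith) measurableSet_Ici hi.integrableOn
    hi.integrableOn, hleft, integral_Ici_eq_integral_Ioi]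
  calc _ ≤ 2 / (Real.pi * T * δ) + 2 / (Real.pi * T * δ) := add_le_add hright hright
    _ = _ := by ring

lemma integrable_mul_fejerKernel {T : ℝ} (hT : 0 < T) {d : ℝ → ℝ} (hd : Measurable d) {η : ℝ}
    (hη : ∀ x, |d x| ≤ η) : Integrable fun x => d x * fejerKernel T x :=
  (integrable_fejerKernel hT).bdd_mul hd.aestronglyMeasurable (Filter.Eventually.of_forall hη)

/-! ### The smoothing inequality -/

/-- Values of a function that cannot decrease fast are controlled by its Fejér means. -/
lemma mul_one_sub_le_of_fejer_mean_le {d : ℝ → ℝ} (hd : Measurable d) {η m T E : ℝ} (hm : 0 < m)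
    (hη : 0 < η) (hT : 0 < T) (hbound : ∀ x, |d x| ≤ η)
    (hlip : ∀ x y, x ≤ y → d x - m * (y - x) ≤ d y)
    (hE : ∀ t, ∫ x, d (t - x) * fejerKernel T x ≤ E) (x₀ : ℝ) :
    d x₀ * (1 - ∫ x in (Set.Ioo (-(η / (2 * m))) (η / (2 * m)))ᶜ, fejerKernel T x)
      ≤ E + η / 2 * (1 - ∫ x in (Set.Ioo (-(η / (2 * m))) (η / (2 * m)))ᶜ, fejerKernel T x)
        + η * ∫ x in (Set.Ioo (-(η / (2 * m))) (η / (2 * m)))ᶜ, fejerKernel T x := by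
  set δ := η / (2 * m) with hδ
  have hmδ : m * δ = η / 2 := by rw [hδ]; field_simp
  have hδ0 : 0 < δ := by positivity
  set S := Set.Ioo (-δ) δ with hS
  have hh := integrable_fejerKernel hT
  have hnn := fejerKernel_nonneg hT.le
  -- The mean is taken at x₀ + δ so that the window |x| < δ lies to the right of x₀, where `hlip`
  -- gives d ≥ d x₀ - η/2 + m x. The kernel is even, so the term m x integrates to zero; outside the
  -- window only d ≥ -η is used.
  have hint : Integrable fun x => d (x₀ + δ - x) * fejerKernel T x :=
    integrable_mul_fejerKernel hT (by fun_prop) fun x => hbound _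
  have hsplit := integral_add_compl (measurableSet_Ioo (a := -δ) (b := δ)) hint
  have hmass := integral_add_compl (measurableSet_Ioo (a := -δ) (b := δ)) hh
  rw [integral_fejerKernel hT] at hmass
  have hodd : ∫ x in S, x * fejerKernel T x = 0 := by
    rw [hS, ← integral_Ioc_eq_integral_Ioo, ← intervalIntegral.integral_of_le (by linarith)]
    have h := intervalIntegral.integral_comp_neg (a := -δ) (b := δ)
      fun x : ℝ => x * fejerKernel T x
    simp only [fejerKernel_neg, neg_mul, neg_neg, intervalIntegral.integral_neg] at h
    linarith
  have hxi : IntegrableOn (fun x => x * fejerKernel T x) S :=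
    ((continuous_id.mul (continuous_fejerKernel T)).integrableOn_Icc (a := -δ) (b := δ)).mono_set
      Set.Ioo_subset_Icc_self
  have hin : (d x₀ - η / 2) * ∫ x in S, fejerKernel T x
      ≤ ∫ x in S, d (x₀ + δ - x) * fejerKernel T x := by
    calc (d x₀ - η / 2) * ∫ x in S, fejerKernel T x
        = ∫ x in S, ((d x₀ - η / 2) * fejerKernel T x + m * (x * fejerKernel T x)) := by
          rw [integral_add (hh.integrableOn.const_mul _) (hxi.const_mul _), integral_const_mul,
            integral_const_mul, hodd, mul_zero, add_zero]
      _ ≤ _ := by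
          refine setIntegral_mono_on ((hh.integrableOn.const_mul _).add (hxi.const_mul _))
            hint.integrableOn measurableSet_Ioo fun x hx => ?_
          have h1 := hlip x₀ (x₀ + δ - x) (by linarith [hx.2])
          have h2 : d x₀ - η / 2 + m * x ≤ d (x₀ + δ - x) := by linarith
          have := mul_le_mul_of_nonneg_right h2 (hnn x)
          linarith
  have hout : -η * ∫ x in Sᶜ, fejerKernel T x
      ≤ ∫ x in Sᶜ, d (x₀ + δ - x) * fejerKernel T x := by
    rw [← integral_const_mul]
    exact setIntegral_mono (hh.integrableOn.const_mul _) hint.integrableOn fun x =>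
      mul_le_mul_of_nonneg_right (abs_le.1 (hbound _)).1 (hnn x)
  have hin' : ∫ x in S, fejerKernel T x = 1 - ∫ x in Sᶜ, fejerKernel T x := by linarith
  rw [hin'] at hin
  have := hE (x₀ + δ)
  linarith

/-- Smoothing inequality: the supremum of a function that cannot decrease fast is controlled by
its Fejér means. -/
lemma iSup_abs_le_of_abs_fejer_mean_le {d : ℝ → ℝ} (hd : Measurable d) {m T E : ℝ} (hm : 0 < m)
    (hT : 0 < T) (hbdd : BddAbove (Set.range fun x => |d x|))
    (hlip : ∀ x y, x ≤ y → d x - m * (y - x) ≤ d y)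
    (hE : ∀ t, |∫ x, d (t - x) * fejerKernel T x| ≤ E) :
    ⨆ x, |d x| ≤ 2 * E + 24 * m / (Real.pi * T) := by
  set η := ⨆ x, |d x| with hη
  have hbound (x : ℝ) : |d x| ≤ η := le_ciSup hbdd x
  have hE0 : 0 ≤ E := (abs_nonneg _).trans (hE 0)
  obtain h0 | hpos := ((abs_nonneg _).trans (hbound 0)).eq_or_lt
  · rw [← h0]; positivity
  have hplus := mul_one_sub_le_of_fejer_mean_le hd hm hpos hT hbound hlip
    fun t => (abs_le.1 (hE t)).2
  -- The reflection x ↦ -d(-x) obeys the same one-sided bound, which covers points where d is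
  -- negative.
  have hminus := mul_one_sub_le_of_fejer_mean_le (d := fun x => -d (-x)) (by fun_prop) hm hpos hT
    (fun x => by rw [abs_neg]; exact hbound _)
    (fun x y hxy => by
      have := hlip (-y) (-x) (by linarith)
      linarith)
    (E := E) (fun t => by
      have h : ∫ x, -d (-(t - x)) * fejerKernel T x
          = -∫ x, d (-t - x) * fejerKernel T x := by
        rw [← integral_neg, ← integral_neg_eq_self]
        refine integral_congr_ae (Filter.Eventually.of_forall fun x => ?_)
        simp only [fejerKernel_neg, neg_mul]
        rw [show -(t - -x) = -t - x by ring]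
      rw [h]
      linarith [(abs_le.1 (hE (-t))).1])
  have htail := setIntegral_compl_Ioo_fejerKernel_le hT (δ := η / (2 * m)) (by positivity)
  have hp1 : 0 ≤ 1 - ∫ x in (Set.Ioo (-(η / (2 * m))) (η / (2 * m)))ᶜ, fejerKernel T x := by
    rw [← integral_fejerKernel hT, sub_nonneg]
    exact setIntegral_le_integral (integrable_fejerKernel hT)
      (Filter.Eventually.of_forall (fejerKernel_nonneg hT.le))
  set p := ∫ x in (Set.Ioo (-(η / (2 * m))) (η / (2 * m)))ᶜ, fejerKernel T x with hp
  have hsup : η * (1 - p) ≤ E + η / 2 * (1 - p) + η * p := by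
    -- The factor moves inside the supremum, so no point attaining it is needed.
    rw [hη, Real.iSup_mul_of_nonneg hp1, ← hη]
    refine ciSup_le fun x => ?_
    obtain h | h := abs_cases (d x)
    · rw [h.1]; exact hplus x
    · rw [h.1]; simpa using hminus (-x)
  have hηp : η * p ≤ 8 * m / (Real.pi * T) := by
    calc η * p ≤ η * (4 / (Real.pi * T * (η / (2 * m)))) := by gcongr
      _ = _ := by field_simp; ring
  -- `hsup` rearranges to η ≤ 2E + 3ηp.
  have : 24 * m / (Real.pi * T) = 3 * (8 * m / (Real.pi * T)) := by ring
  linarith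

/-! ### Fourier inversion for smoothed distribution functions -/

/-- Dominated convergence. The limit fixes the constant of integration when increments are turned
into values. -/
lemma tendsto_integral_cdf_mul_fejerKernel (P : Measure ℝ) {T : ℝ} (hT : 0 < T) :
    Filter.Tendsto (fun t => ∫ x, cdf P (t - x) * fejerKernel T x) Filter.atBot (nhds 0) := by
  have h := tendsto_integral_filter_of_dominated_convergence (μ := volume) (l := Filter.atBot)
    (F := fun t x => cdf P (t - x) * fejerKernel T x) (f := fun _ => 0) (fejerKernel T)
    (Filter.Eventually.of_forall fun t => by
      have hm : Measurable (cdf P) := (monotone_cdf P).measurable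
      exact ((hm.comp (by fun_prop : Measurable fun x => t - x)).mul
        (continuous_fejerKernel T).measurable).aestronglyMeasurable)
    (Filter.Eventually.of_forall fun t => Filter.Eventually.of_forall fun x => by
      rw [Real.norm_of_nonneg (mul_nonneg (cdf_nonneg P _) (fejerKernel_nonneg hT.le x))]
      exact mul_le_of_le_one_left (fejerKernel_nonneg hT.le x) (cdf_le_one P _))
    (integrable_fejerKernel hT)
    (Filter.Eventually.of_forall fun x => by
      simpa [sub_eq_add_neg] using ((tendsto_cdf_atBot P).comp
        (Filter.tendsto_atBot_add_const_right _ (-x) Filter.tendsto_id)).mul_const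
          (fejerKernel T x))
  simpa using h

section Inversion

variable (P : Measure ℝ) [IsProbabilityMeasure P]

/-- Increments of a smoothed distribution function as integrals of the smoothed density. -/
lemma integral_cdf_mul_fejerKernel_sub {T : ℝ} (hT : 0 < T) {a b : ℝ} (hab : a ≤ b) :
    (∫ x, cdf P (b - x) * fejerKernel T x) - ∫ x, cdf P (a - x) * fejerKernel T x
      = ∫ z in a..b, ∫ y, fejerKernel T (z - y) ∂P := by
  have hh := integrable_fejerKernel hT
  have hcont := continuous_fejerKernel T
  -- Fubini: a convolution's distribution function can be computed by conditioning on either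
  -- summand.
  have hcdf (t : ℝ) : ∫ x, cdf P (t - x) * fejerKernel T x
      = ∫ y, (∫ x in Set.Iic (t - y), fejerKernel T x) ∂P := by
    have hS : MeasurableSet {p : ℝ × ℝ | p.2 + p.1 ≤ t} :=
      measurableSet_le (by fun_prop) measurable_const
    have hint : Integrable (Function.uncurry fun x y : ℝ =>
        {p : ℝ × ℝ | p.2 + p.1 ≤ t}.indicator (fun p => fejerKernel T p.1) (x, y))
        (volume.prod P) := (hh.comp_fst P).indicator hS
    calc ∫ x, cdf P (t - x) * fejerKernel T x
        = ∫ x, ∫ y, {p : ℝ × ℝ | p.2 + p.1 ≤ t}.indicator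
            (fun p => fejerKernel T p.1) (x, y) ∂P := by
          refine integral_congr_ae (Filter.Eventually.of_forall fun x => ?_)
          have : (fun y => {p : ℝ × ℝ | p.2 + p.1 ≤ t}.indicator
              (fun p => fejerKernel T p.1) (x, y))
              = (Set.Iic (t - x)).indicator fun _ => fejerKernel T x := by
            ext y
            simp only [Set.indicator_apply, Set.mem_ofPred_eq, Set.mem_Iic, le_sub_iff_add_le]
          simp only [this]
          rw [integral_indicator_const _ measurableSet_Iic, cdf_eq_real, smul_eq_mul]
      _ = ∫ y, (∫ x, {p : ℝ × ℝ | p.2 + p.1 ≤ t}.indicator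
            (fun p => fejerKernel T p.1) (x, y)) ∂P :=
          integral_integral_swap hint
      _ = _ := by
          refine integral_congr_ae (Filter.Eventually.of_forall fun y => ?_)
          simp only
          rw [← integral_indicator measurableSet_Iic]
          refine integral_congr_ae (Filter.Eventually.of_forall fun x => ?_)
          simp only [Set.indicator_apply, Set.mem_ofPred_eq, Set.mem_Iic, le_sub_iff_add_le, add_comm]
  have hKcont : Continuous fun s : ℝ => ∫ x in Set.Iic s, fejerKernel T x := by
    have : (fun s : ℝ => ∫ x in Set.Iic s, fejerKernel T x) = fun s =>
        (∫ x in Set.Iic (0 : ℝ), fejerKernel T x) + ∫ x in (0 : ℝ)..s, fejerKernel T x := by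
      ext s
      rw [← intervalIntegral.integral_Iic_sub_Iic hh.integrableOn hh.integrableOn]
      ring
    rw [this]
    exact continuous_const.add (intervalIntegral.continuous_primitive
      (fun _ _ => hcont.intervalIntegrable _ _) _)
  have hK1 (s : ℝ) : ‖∫ x in Set.Iic s, fejerKernel T x‖ ≤ 1 := by
    rw [Real.norm_of_nonneg (setIntegral_nonneg measurableSet_Iic fun x _ =>
      fejerKernel_nonneg hT.le x), ← integral_fejerKernel hT]
    exact setIntegral_le_integral hh (Filter.Eventually.of_forall (fejerKernel_nonneg hT.le))
  have hKi (t : ℝ) : Integrable (fun y => ∫ x in Set.Iic (t - y), fejerKernel T x) P :=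
    (integrable_const (1 : ℝ)).mono' (hKcont.comp (by fun_prop)).aestronglyMeasurable
      (Filter.Eventually.of_forall fun y => hK1 _)
  have hbd (x : ℝ) : ‖fejerKernel T x‖ ≤ T / (2 * Real.pi) := by
    rw [Real.norm_of_nonneg (fejerKernel_nonneg hT.le x)]
    exact mul_le_of_le_one_right (by positivity) ((sq_le_one_iff_abs_le_one _).2
      (abs_le.2 ⟨Real.neg_one_le_sinc _, Real.sinc_le_one _⟩))
  rw [hcdf, hcdf, ← integral_sub (hKi b) (hKi a), intervalIntegral.integral_of_le hab,
    integral_integral_swap]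
  · refine integral_congr_ae (Filter.Eventually.of_forall fun y => ?_)
    simp only
    rw [intervalIntegral.integral_Iic_sub_Iic hh.integrableOn hh.integrableOn,
      ← intervalIntegral.integral_of_le hab,
      intervalIntegral.integral_comp_sub_right (fejerKernel T)]
  · exact (integrable_const (T / (2 * Real.pi))).mono'
      (hcont.comp (by fun_prop)).aestronglyMeasurable
      (Filter.Eventually.of_forall fun p => hbd _)

/-- Fourier representation of the smoothed density. -/
lemma integral_fejerKernel_sub {T : ℝ} (hT : 0 < T) (z : ℝ) :
    ((∫ y, fejerKernel T (z - y) ∂P : ℝ) : ℂ)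
      = (2 * Real.pi : ℂ)⁻¹ * ∫ u in -T..T, ((1 - |u| / T : ℝ) : ℂ) * charFun P u
        * Complex.exp (-(u * z) * Complex.I) := by
  have hpi : (2 * Real.pi : ℂ) ≠ 0 := by
    exact_mod_cast (by positivity : (2 * Real.pi : ℝ) ≠ 0)
  rw [← integral_complex_ofReal, eq_inv_mul_iff_mul_eq₀ hpi, ← integral_const_mul]
  have h1 (y : ℝ) : (2 * Real.pi : ℂ) * (fejerKernel T (z - y) : ℂ)
      = ∫ u in Set.Ioc (-T) T, ((1 - |u| / T : ℝ) : ℂ)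
        * Complex.exp (u * y * Complex.I) * Complex.exp (-(u * z) * Complex.I) := by
    rw [← fejerKernel_neg, ← integral_triangle_mul_cexp hT,
      intervalIntegral.integral_of_le (by linarith)]
    refine integral_congr_ae (Filter.Eventually.of_forall fun u => ?_)
    simp only
    rw [mul_assoc (_ : ℂ) (Complex.exp _), ← Complex.exp_add]
    congr 2
    push_cast
    ring
  simp_rw [h1]
  rw [integral_integral_swap, intervalIntegral.integral_of_le (by linarith)]
  · refine integral_congr_ae (Filter.Eventually.of_forall fun u => ?_)
    simp only
    rw [integral_mul_const, integral_const_mul, charFun_apply_real]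
  · have hdom : Integrable (fun p : ℝ × ℝ => |1 - |p.2| / T|)
        (P.prod (volume.restrict (Set.Ioc (-T) T))) :=
      Integrable.comp_snd (f := fun u : ℝ => |1 - |u| / T|)
        ((Continuous.integrableOn_Icc (by fun_prop)).mono_set Set.Ioc_subset_Icc_self) P
    refine hdom.mono' (Continuous.aestronglyMeasurable (by fun_prop))
      (Filter.Eventually.of_forall fun p => ?_)
    simp only [Function.uncurry]
    rw [norm_mul, norm_mul, ← Complex.ofReal_mul, Complex.norm_exp_ofReal_mul_I,
      ← Complex.ofReal_mul, ← Complex.ofReal_neg, Complex.norm_exp_ofReal_mul_I, Complex.norm_real]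
    simp

end Inversion

/-- Fourier inversion for the difference of two smoothed distribution functions. -/
lemma abs_integral_cdf_sub_mul_fejerKernel_le (P Q : Measure ℝ) [IsProbabilityMeasure P]
    [IsProbabilityMeasure Q] {T : ℝ} (hT : 0 < T)
    (hint : IntervalIntegrable (fun u => ‖charFun P u - charFun Q u‖ / |u|) volume (-T) T) (t : ℝ) :
    |∫ x, (cdf P (t - x) - cdf Q (t - x)) * fejerKernel T x|
      ≤ (2 * Real.pi)⁻¹ * ∫ u in -T..T, ‖charFun P u - charFun Q u‖ / |u| := by
  have hTT : -T ≤ T := by linarith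
  set g : ℝ → ℂ := fun u => ((1 - |u| / T : ℝ) : ℂ) * (charFun P u - charFun Q u) with hg
  -- The factor i/u = 1/(-iu) comes from integrating e^{-iuz} in z. The junk value at u = 0 is
  -- harmless, a single point being null.
  set k : ℝ → ℂ := (Set.Ioc (-T) T).indicator fun u => g u * (Complex.I / u) with hk
  set D : ℝ → ℝ := fun t => ∫ x, (cdf P (t - x) - cdf Q (t - x)) * fejerKernel T x with hD
  set Ψ : ℝ → ℂ := fun z => ∫ u, k u * Complex.exp (-(u * z) * Complex.I) with hΨ
  have hgm : Measurable g := by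
    have := measurable_charFun (μ := P)
    have := measurable_charFun (μ := Q)
    fun_prop
  have hkm : Measurable k := (hgm.mul (by fun_prop)).indicator measurableSet_Ioc
  have hweight (u : ℝ) (hu : u ∈ Set.Ioc (-T) T) : ‖((1 - |u| / T : ℝ) : ℂ)‖ ≤ 1 := by
    have h1 : |u| / T ≤ 1 := (div_le_one hT).2 (abs_le.2 ⟨hu.1.le, hu.2⟩)
    have h2 : 0 ≤ |u| / T := by positivity
    rw [Complex.norm_real, Real.norm_of_nonneg (by linarith)]
    linarith
  have hknorm (u : ℝ) : ‖k u‖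
      ≤ (Set.Ioc (-T) T).indicator (fun u => ‖charFun P u - charFun Q u‖ / |u|) u := by
    rw [hk]
    by_cases hu : u ∈ Set.Ioc (-T) T
    · have hgu : ‖g u‖ ≤ ‖charFun P u - charFun Q u‖ :=
        (norm_mul _ _).trans_le (mul_le_of_le_one_left (norm_nonneg _) (hweight u hu))
      rw [Set.indicator_of_mem hu, Set.indicator_of_mem hu, norm_mul, norm_div,
        Complex.norm_I, Complex.norm_real, Real.norm_eq_abs, ← div_eq_mul_one_div]
      exact div_le_div_of_nonneg_right hgu (abs_nonneg u)
    · simp [Set.indicator_of_notMem hu]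
  have hbi : Integrable
      ((Set.Ioc (-T) T).indicator fun u => ‖charFun P u - charFun Q u‖ / |u|) :=
    (integrable_indicator_iff measurableSet_Ioc).2
      ((intervalIntegrable_iff_integrableOn_Ioc_of_le hTT).1 hint)
  have hki : Integrable k := hbi.mono' hkm.aestronglyMeasurable (Filter.Eventually.of_forall hknorm)
  have hexp (u z : ℝ) : ‖Complex.exp (-(u * z) * Complex.I)‖ = 1 := by
    rw [← Complex.ofReal_mul, ← Complex.ofReal_neg, Complex.norm_exp_ofReal_mul_I]
  have hkei (z : ℝ) : Integrable fun u : ℝ => k u * Complex.exp (-(u * z) * Complex.I) :=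
    hki.mul_bdd (c := 1) (Continuous.aestronglyMeasurable (by fun_prop))
      (Filter.Eventually.of_forall fun u => (hexp u z).le)
  have hcdfi (ρ : Measure ℝ) (t : ℝ) : Integrable fun x => cdf ρ (t - x) * fejerKernel T x :=
    integrable_mul_fejerKernel hT (η := 1)
      ((monotone_cdf ρ).measurable.comp (by fun_prop : Measurable fun x => t - x))
      (fun x => abs_le.2 ⟨by linarith [cdf_nonneg ρ (t - x)], cdf_le_one ρ _⟩)
  have hDsub (t : ℝ) : D t = (∫ x, cdf P (t - x) * fejerKernel T x)
      - ∫ x, cdf Q (t - x) * fejerKernel T x := by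
    rw [hD, ← integral_sub (hcdfi P t) (hcdfi Q t)]
    simp_rw [sub_mul]
  have hgbd (u : ℝ) (hu : u ∈ Set.Ioc (-T) T) : ‖g u‖ ≤ 2 := by
    rw [hg, norm_mul]
    have h1 := norm_sub_le (charFun P u) (charFun Q u)
    have h2 := norm_charFun_le_one (μ := P) u
    have h3 := norm_charFun_le_one (μ := Q) u
    nlinarith [hweight u hu, norm_nonneg ((1 - |u| / T : ℝ) : ℂ),
      norm_nonneg (charFun P u - charFun Q u)]
  have hincr (a b : ℝ) (hab : a ≤ b) :
      ((D b - D a : ℝ) : ℂ) = (2 * Real.pi : ℂ)⁻¹ * (Ψ b - Ψ a) := by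
    have hfe (ρ : Measure ℝ) [IsProbabilityMeasure ρ] (z : ℝ) : IntervalIntegrable
        (fun u : ℝ => ((1 - |u| / T : ℝ) : ℂ) * charFun ρ u * Complex.exp (-(u * z) * Complex.I))
        volume (-T) T :=
      (continuous_charFun.intervalIntegrable _ _).continuousOn_mul
        (f := fun u => charFun ρ u) (g := fun u : ℝ => ((1 - |u| / T : ℝ) : ℂ))
        (Continuous.continuousOn (by fun_prop)) |>.mul_continuousOn
        (Continuous.continuousOn (by fun_prop))
    have hdens (ρ : Measure ℝ) [IsProbabilityMeasure ρ] :
        Continuous fun z => ∫ y, fejerKernel T (z - y) ∂ρ := by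
      have hcf := continuous_fejerKernel T
      refine continuous_of_dominated (bound := fun _ => T / (2 * Real.pi))
        (fun z => (hcf.comp (by fun_prop)).aestronglyMeasurable)
        (fun z => Filter.Eventually.of_forall fun y => ?_) (integrable_const _)
        (Filter.Eventually.of_forall fun y => hcf.comp (by fun_prop))
      rw [Real.norm_of_nonneg (fejerKernel_nonneg hT.le _)]
      exact mul_le_of_le_one_right (by positivity) ((sq_le_one_iff_abs_le_one _).2
        (abs_le.2 ⟨Real.neg_one_le_sinc _, Real.sinc_le_one _⟩))
    have h1 : D b - D a = ∫ z in a..b, (∫ y, fejerKernel T (z - y) ∂P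
        - ∫ y, fejerKernel T (z - y) ∂Q) := by
      rw [intervalIntegral.integral_sub ((hdens P).intervalIntegrable _ _)
        ((hdens Q).intervalIntegrable _ _), ← integral_cdf_mul_fejerKernel_sub P hT hab,
        ← integral_cdf_mul_fejerKernel_sub Q hT hab, hDsub, hDsub]
      ring
    have h2 (z : ℝ) : ((∫ y, fejerKernel T (z - y) ∂P - ∫ y, fejerKernel T (z - y) ∂Q : ℝ) : ℂ)
        = (2 * Real.pi : ℂ)⁻¹ * ∫ u in Set.Ioc (-T) T,
          g u * Complex.exp (-(u * z) * Complex.I) := by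
      rw [Complex.ofReal_sub, integral_fejerKernel_sub P hT, integral_fejerKernel_sub Q hT,
        ← mul_sub, ← intervalIntegral.integral_sub (hfe P z) (hfe Q z),
        ← intervalIntegral.integral_of_le hTT]
      congr 2
      ext u
      rw [hg]
      ring
    have hgi : IntegrableOn g (Set.Ioc (-T) T) :=
      IntegrableOn.of_bound measure_Ioc_lt_top hgm.aestronglyMeasurable 2
        ((ae_restrict_iff' measurableSet_Ioc).2 (Filter.Eventually.of_forall hgbd))
    have hswap : Integrable (Function.uncurry fun z u : ℝ =>
        g u * Complex.exp (-(u * z) * Complex.I))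
        ((volume.restrict (Set.Ioc a b)).prod (volume.restrict (Set.Ioc (-T) T))) := by
      refine (Integrable.comp_snd (f := g) hgi _).mul_bdd (c := 1)
        (Continuous.aestronglyMeasurable (by fun_prop)) (Filter.Eventually.of_forall fun p => ?_)
      exact (hexp p.2 p.1).le
    have h3 : ∫ z in Set.Ioc a b, (∫ u in Set.Ioc (-T) T, g u * Complex.exp (-(u * z) * Complex.I))
        = Ψ b - Ψ a := by
      rw [integral_integral_swap hswap, hΨ]
      simp only
      rw [← integral_sub (hkei b) (hkei a), ← integral_indicator measurableSet_Ioc]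
      refine integral_congr_ae ?_
      filter_upwards [Measure.ae_ne volume (0 : ℝ)] with u hu0
      rw [hk]
      by_cases hu : u ∈ Set.Ioc (-T) T
      · rw [Set.indicator_of_mem hu, Set.indicator_of_mem hu, integral_const_mul,
          ← intervalIntegral.integral_of_le hab]
        have hc : -(u : ℂ) * Complex.I ≠ 0 := by simp [hu0]
        have h := integral_exp_mul_complex (a := a) (b := b) hc
        have hrw (z : ℝ) : -((u : ℂ) * z) * Complex.I = -(u : ℂ) * Complex.I * z := by ring
        simp_rw [hrw]
        rw [h]
        have hu' : (u : ℂ) ≠ 0 := by exact_mod_cast hu0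
        have hI : -(u : ℂ) * Complex.I * (Complex.I / u) = 1 := by
          field_simp
          simp
        rw [div_eq_mul_inv, inv_eq_of_mul_eq_one_right hI]
        ring
      · simp [Set.indicator_of_notMem hu]
    rw [h1, ← intervalIntegral.integral_ofReal, intervalIntegral.integral_of_le hab]
    simp_rw [h2]
    rw [integral_const_mul, h3]
  have hDlim : Filter.Tendsto D Filter.atBot (nhds 0) := by
    have h := (tendsto_integral_cdf_mul_fejerKernel P hT).sub
      (tendsto_integral_cdf_mul_fejerKernel Q hT)
    rw [sub_zero] at h
    exact h.congr fun t => (hDsub t).symm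
  -- Riemann-Lebesgue lemma, with the frequency rescaled by 2π to match the Fourier convention.
  have hΨlim : Filter.Tendsto Ψ Filter.atBot (nhds 0) := by
    have h := ((Real.tendsto_integral_exp_smul_cocompact k).mono_left atBot_le_cocompact).comp
      (Filter.tendsto_id.atBot_div_const (by positivity : (0 : ℝ) < 2 * Real.pi))
    refine h.congr fun z => integral_congr_ae (Filter.Eventually.of_forall fun u => ?_)
    simp only [id, Circle.smul_def, Real.fourierChar_apply, smul_eq_mul]
    rw [mul_comm]
    congr 2
    have : (Real.pi : ℂ) ≠ 0 := by exact_mod_cast Real.pi_ne_zero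
    push_cast
    field_simp
  -- Let a → -∞ in `hincr`.
  have hmain : ((D t : ℝ) : ℂ) = (2 * Real.pi : ℂ)⁻¹ * Ψ t := by
    have hl : Filter.Tendsto (fun a => ((D t - D a : ℝ) : ℂ)) Filter.atBot (nhds (D t : ℂ)) := by
      have := (Complex.continuous_ofReal.tendsto _).comp (hDlim.const_sub (D t))
      simpa [Function.comp_def] using this
    have hr : Filter.Tendsto (fun a => (2 * Real.pi : ℂ)⁻¹ * (Ψ t - Ψ a)) Filter.atBot
        (nhds ((2 * Real.pi : ℂ)⁻¹ * Ψ t)) := by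
      simpa using (hΨlim.const_sub (Ψ t)).const_mul ((2 * Real.pi : ℂ)⁻¹)
    refine tendsto_nhds_unique hl (hr.congr' ?_)
    filter_upwards [Filter.eventually_le_atBot t] with a ha
    exact (hincr a t ha).symm
  have hΨnorm : ‖Ψ t‖ ≤ ∫ u in -T..T, ‖charFun P u - charFun Q u‖ / |u| := by
    rw [intervalIntegral.integral_of_le hTT, ← integral_indicator measurableSet_Ioc]
    refine norm_integral_le_of_norm_le hbi (Filter.Eventually.of_forall fun u => ?_)
    rw [norm_mul, hexp, mul_one]
    exact hknorm u
  calc |D t| = ‖((D t : ℝ) : ℂ)‖ := by rw [Complex.norm_real, Real.norm_eq_abs]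
    _ = (2 * Real.pi)⁻¹ * ‖Ψ t‖ := by
        rw [hmain, norm_mul, norm_inv, norm_mul, Complex.norm_real,
          Real.norm_of_nonneg Real.pi_pos.le]
        norm_num
    _ ≤ _ := by gcongr

/-! ### Esseen's inequality and the final estimate -/

/-- **Esseen's smoothing inequality**. -/
theorem ksDist_le_of_charFun (P Q : Measure ℝ) [IsProbabilityMeasure P] [IsProbabilityMeasure Q]
    {m T : ℝ} (hm : 0 < m) (hT : 0 < T)
    (hQ : ∀ x y, x ≤ y → cdf Q y - cdf Q x ≤ m * (y - x))
    (hint : IntervalIntegrable (fun u => ‖charFun P u - charFun Q u‖ / |u|) volume (-T) T) :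
    ksDist P Q ≤ Real.pi⁻¹ * (∫ u in -T..T, ‖charFun P u - charFun Q u‖ / |u|)
      + 24 * m / (Real.pi * T) := by
  have h := iSup_abs_le_of_abs_fejer_mean_le (d := fun x => cdf P x - cdf Q x)
    ((monotone_cdf P).measurable.sub (monotone_cdf Q).measurable) hm hT
    ⟨1, by
      rintro _ ⟨x, rfl⟩
      exact abs_le.2 ⟨by linarith [cdf_nonneg P x, cdf_le_one Q x],
        by linarith [cdf_nonneg Q x, cdf_le_one P x]⟩⟩
    (fun x y hxy => by linarith [hQ x y hxy, monotone_cdf P hxy])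
    (abs_integral_cdf_sub_mul_fejerKernel_le P Q hT hint)
  refine h.trans_eq ?_
  have := Real.pi_ne_zero
  congr 1
  field_simp

lemma cdf_gaussianReal_sub_le {x y : ℝ} (hxy : x ≤ y) :
    cdf (gaussianReal 0 1) y - cdf (gaussianReal 0 1) x
      ≤ (Real.sqrt (2 * Real.pi))⁻¹ * (y - x) := by
  have hpdf (z : ℝ) : ‖gaussianPDFReal 0 1 z‖ ≤ (Real.sqrt (2 * Real.pi))⁻¹ := by
    rw [Real.norm_of_nonneg (gaussianPDFReal_nonneg _ _ _), gaussianPDFReal]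
    simp only [NNReal.coe_one, mul_one]
    refine mul_le_of_le_one_right (by positivity) (Real.exp_le_one_iff.2 ?_)
    have := sq_nonneg (z - 0)
    linarith
  rw [cdf_eq_real, cdf_eq_real, measureReal_def, measureReal_def,
    gaussianReal_apply_eq_integral _ one_ne_zero, gaussianReal_apply_eq_integral _ one_ne_zero,
    ENNReal.toReal_ofReal (integral_nonneg fun z => gaussianPDFReal_nonneg _ _ _),
    ENNReal.toReal_ofReal (integral_nonneg fun z => gaussianPDFReal_nonneg _ _ _),
    intervalIntegral.integral_Iic_sub_Iic (integrable_gaussianPDFReal 0 1).integrableOn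
      (integrable_gaussianPDFReal 0 1).integrableOn]
  refine (Real.le_norm_self _).trans ?_
  have h := intervalIntegral.norm_integral_le_of_norm_le_const (a := x) (b := y)
    (f := gaussianPDFReal 0 1) fun z _ => hpdf z
  rwa [abs_of_nonneg (sub_nonneg.2 hxy)] at h

/-- A Kolmogorov-Smirnov bound from a quadratic and a uniform bound on the difference of the
characteristic functions. -/
lemma ksDist_gaussianReal_le_of_charFun {P : Measure ℝ} [IsProbabilityMeasure P] {B T : ℝ}
    (hB : 0 < B) (hT : 0 < T)
    (hsq : ∀ u, ‖charFun P u - charFun (gaussianReal 0 1) u‖ ≤ u ^ 2)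
    (hunif : ∀ u, |u| ≤ T → ‖charFun P u - charFun (gaussianReal 0 1) u‖ ≤ B) :
    ksDist P (gaussianReal 0 1) ≤ Real.pi⁻¹ * (2 * B * Real.log (1 + T ^ 2 / B))
      + 24 * (Real.sqrt (2 * Real.pi))⁻¹ / (Real.pi * T) := by
  have hTT : -T ≤ T := by linarith
  -- The quotient is at most both |u| and B/|u|, hence at most their harmonic mean, which has an
  -- elementary integral and needs no case split at |u| = √B.
  have hpt (u : ℝ) (hu : u ∈ Set.Icc (-T) T) :
      ‖charFun P u - charFun (gaussianReal 0 1) u‖ / |u| ≤ 2 * B * |u| / (B + u ^ 2) := by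
    obtain rfl | hu0 := eq_or_ne u 0
    · simp
    have hpos : 0 < |u| := abs_pos.2 hu0
    rw [div_le_div_iff₀ hpos (by positivity)]
    have h1 := hsq u
    have h2 := hunif u (abs_le.2 hu)
    have h3 : 2 * B * |u| * |u| = u ^ 2 * B + B * u ^ 2 := by rw [← sq_abs u]; ring
    rw [h3, mul_add]
    gcongr
  have hcont : Continuous fun u : ℝ => 2 * B * |u| / (B + u ^ 2) :=
    Continuous.div (by fun_prop) (by fun_prop) fun u => by positivity
  have hint : IntervalIntegrable
      (fun u => ‖charFun P u - charFun (gaussianReal 0 1) u‖ / |u|) volume (-T) T := by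
    refine (hcont.intervalIntegrable (-T) T).mono_fun' ?_ ?_
    · have := measurable_charFun (μ := P)
      have := measurable_charFun (μ := gaussianReal 0 1)
      exact Measurable.aestronglyMeasurable (by fun_prop)
    · rw [Set.uIoc_of_le hTT]
      refine (ae_restrict_iff' measurableSet_Ioc).2 (Filter.Eventually.of_forall fun u hu => ?_)
      dsimp only
      rw [Real.norm_of_nonneg (by positivity)]
      exact hpt u (Set.Ioc_subset_Icc_self hu)
  refine (ksDist_le_of_charFun P (gaussianReal 0 1) (by positivity) hT
    (fun x y => cdf_gaussianReal_sub_le) hint).trans ?_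
  rw [← integral_two_mul_abs_div_add_sq hB hT.le]
  gcongr
  exact intervalIntegral.integral_mono_on hTT hint (hcont.intervalIntegrable _ _) hpt

/-- The elementary estimate matching the smoothing bound to the final rate; here `√γ e^{-3L/8}`
bounds the difference of characteristic functions on `|u| ≤ √(γ L) / 2`. -/
lemma two_mul_mul_log_le {γ L : ℝ} (hγ : 0 < γ) (hL : 0 < L) :
    2 * (Real.sqrt γ * Real.exp (-(3 * L / 8)))
        * Real.log (1 + γ * L / 4 / (Real.sqrt γ * Real.exp (-(3 * L / 8))))
      ≤ Real.sqrt 2 * (1 + γ) * (Real.sqrt (γ / 2) * Real.exp (-(L / 4)))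
        * Real.sqrt (2 * L) := by
  obtain ⟨a, ha, rfl⟩ : ∃ a, 0 < a ∧ γ = a ^ 2 :=
    ⟨_, Real.sqrt_pos.2 hγ, (Real.sq_sqrt hγ.le).symm⟩
  obtain ⟨l, hl, rfl⟩ : ∃ l, 0 < l ∧ L = l ^ 2 :=
    ⟨_, Real.sqrt_pos.2 hL, (Real.sq_sqrt hL.le).symm⟩
  rw [Real.sqrt_sq ha.le, Real.sqrt_div (sq_nonneg a), Real.sqrt_sq ha.le,
    Real.sqrt_mul zero_le_two, Real.sqrt_sq hl.le]
  have hlog : Real.log (1 + a ^ 2 * l ^ 2 / 4 / (a * Real.exp (-(3 * l ^ 2 / 8))))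
      ≤ a * l ^ 2 / 4 + 3 * l ^ 2 / 8 := by
    have h1 : a ^ 2 * l ^ 2 / 4 / (a * Real.exp (-(3 * l ^ 2 / 8)))
        = a * l ^ 2 / 4 * Real.exp (3 * l ^ 2 / 8) := by
      rw [Real.exp_neg]; field_simp
    rw [h1]
    have h2 : 1 ≤ Real.exp (3 * l ^ 2 / 8) := Real.one_le_exp (by positivity)
    calc Real.log (1 + a * l ^ 2 / 4 * Real.exp (3 * l ^ 2 / 8))
        ≤ Real.log ((1 + a * l ^ 2 / 4) * Real.exp (3 * l ^ 2 / 8)) :=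
          Real.log_le_log (by positivity) (by linarith)
      _ = Real.log (1 + a * l ^ 2 / 4) + 3 * l ^ 2 / 8 := by
          rw [Real.log_mul (by positivity) (Real.exp_ne_zero _), Real.log_exp]
      _ ≤ _ := by
          have := Real.log_le_sub_one_of_pos (by positivity : 0 < 1 + a * l ^ 2 / 4)
          linarith
  -- The factor e^{-L/4} is the one present in (γε)^{1/4}; the remaining e^{-L/8} absorbs one power
  -- of l = √L.
  have hexp : Real.exp (-(3 * l ^ 2 / 8)) = Real.exp (-(l ^ 2 / 4)) * Real.exp (-(l ^ 2 / 8)) := by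
    rw [← Real.exp_add]; ring_nf
  have hq : l * Real.exp (-(l ^ 2 / 8)) ≤ Real.sqrt 2 := by
    have h1 : l * Real.sqrt 2 ≤ 2 * (1 + l ^ 2 / 8) := by
      nlinarith [sq_nonneg (l - 2 * Real.sqrt 2), Real.sq_sqrt (zero_le_two (α := ℝ))]
    have h2 := Real.add_one_le_exp (l ^ 2 / 8)
    have h3 : l * Real.sqrt 2 ≤ 2 * Real.exp (l ^ 2 / 8) := by linarith
    rw [Real.exp_neg, ← div_eq_mul_inv, div_le_iff₀ (Real.exp_pos _)]
    nlinarith [Real.sq_sqrt (zero_le_two (α := ℝ)), Real.sqrt_nonneg 2]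
  have hs2 : Real.sqrt 2 * Real.sqrt 2 = 2 := Real.mul_self_sqrt zero_le_two
  set e := Real.exp (-(l ^ 2 / 4)) with he
  have he0 : 0 < e := Real.exp_pos _
  calc _ ≤ 2 * (a * Real.exp (-(3 * l ^ 2 / 8))) * (a * l ^ 2 / 4 + 3 * l ^ 2 / 8) := by gcongr
    _ = a * e * l * (l * Real.exp (-(l ^ 2 / 8))) * (a / 2 + 3 / 4) := by rw [hexp]; ring
    _ ≤ a * e * l * Real.sqrt 2 * (a / 2 + 3 / 4) := by gcongr
    _ = a * e * l * Real.sqrt 2 * (a / 2 + 3 / 4) := by ring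
    _ ≤ a * e * l * Real.sqrt 2 * (1 + a ^ 2) := by
        refine mul_le_mul_of_nonneg_left ?_ (by positivity)
        -- The difference of the two factors is (a - 1/4)² + 3/16.
        nlinarith [sq_nonneg (a - 1 / 4)]
    _ = _ := by
        field_simp

/-- The hypotheses force `0 ≤ ε`. At `ε = 0` the right-hand side evaluates to `0`, which is also
its limit as `ε` decreases to `0`. -/
theorem mainTheorem12 {Ω : Type*} [MeasurableSpace Ω] (μ : Measure Ω) [IsProbabilityMeasure μ]
    (X Z : Ω → ℝ) (hX : AEMeasurable X μ)
    (hmean : ∫ ω, X ω ∂μ = 0) (hvar : ∫ ω, X ω ^ 2 ∂μ = 1)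
    (hZ : HasLaw Z (gaussianReal 0 1) μ) (hXZ : IndepFun X Z μ)
    (γ ε : ℝ) (hγ : 0 < γ) (hγε : 4 * ε < γ)
    (hcap : (gaussianCapacity γ : EReal) - (mutualInfo μ X (channelOutput γ X Z) : EReal)
      ≤ (ε : EReal)) :
    ksDist (μ.map X) (gaussianReal 0 1) ≤
      24 / Real.pi ^ (3 / 2 : ℝ) * Real.sqrt (2 / (γ * Real.log (γ / (4 * ε))))
        + Real.sqrt 2 / Real.pi * (1 + γ) * (γ * ε) ^ (1 / 4 : ℝ)
          * Real.sqrt (2 * Real.log (γ / (4 * ε))) := by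
  have hP := Measure.isProbabilityMeasure_map hX
  obtain ⟨hD, hDε⟩ := klDiv_channelOutput_le hX hvar hZ hXZ hγ.le hcap
  have hdec := norm_charFun_sub_charFun_gaussianReal_le_exp hX hZ hXZ hγ hD
  obtain h0 | hε := (ENNReal.toReal_nonneg.trans hDε).eq_or_lt
  · have heq : μ.map X = gaussianReal 0 1 := by
      refine Measure.ext_of_charFun (funext fun u => ?_)
      have h := hdec u
      rw [le_antisymm (hDε.trans h0.ge) ENNReal.toReal_nonneg, Real.sqrt_zero, mul_zero,
        mul_zero] at h
      exact sub_eq_zero.1 (norm_le_zero_iff.1 h)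
    -- Here γ/0 = 0 and log 0 = 0 by convention, so both terms on the right vanish.
    rw [heq, ksDist, ← h0]
    simp
  have hratio : 0 < γ / (4 * ε) := by positivity
  have hL : 0 < Real.log (γ / (4 * ε)) :=
    Real.log_pos ((one_lt_div (by positivity)).2 hγε)
  set L := Real.log (γ / (4 * ε)) with hLdef
  have hεL : ε = γ * Real.exp (-L) / 4 := by
    rw [hLdef, Real.exp_neg, Real.exp_log hratio]
    field_simp
  -- With this cutoff u²/(2γ) ≤ L/8, so the uniform bound is 2√ε e^{L/8} = √γ e^{-3L/8}.
  have hT : 0 < Real.sqrt (γ * L) / 2 := by positivity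
  have hT2 : (Real.sqrt (γ * L) / 2) ^ 2 = γ * L / 4 := by
    rw [div_pow, Real.sq_sqrt (by positivity)]
    norm_num
  have hsqε : Real.sqrt ε = Real.sqrt γ * Real.exp (-(L / 2)) / 2 := by
    rw [Real.sqrt_eq_iff_mul_self_eq hε.le (by positivity), hεL]
    have h1 := Real.mul_self_sqrt hγ.le
    have h2 : Real.exp (-L) = Real.exp (-(L / 2)) * Real.exp (-(L / 2)) := by
      rw [← Real.exp_add]; ring_nf
    rw [h2]
    linear_combination (-Real.exp (-(L / 2)) * Real.exp (-(L / 2)) / 4) * h1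
  have hunif (u : ℝ) (hu : |u| ≤ Real.sqrt (γ * L) / 2) :
      ‖charFun (μ.map X) u - charFun (gaussianReal 0 1) u‖
        ≤ Real.sqrt γ * Real.exp (-(3 * L / 8)) := by
    have hu2 : u ^ 2 / (2 * γ) ≤ L / 8 := by
      have : u ^ 2 ≤ γ * L / 4 := by
        rw [← hT2, ← sq_abs u]
        gcongr
      rw [div_le_iff₀ (by positivity)]
      linarith
    calc _ ≤ _ := hdec u
      _ ≤ Real.exp (L / 8) * (2 * Real.sqrt ε) := by gcongr
      _ = Real.sqrt γ * (Real.exp (L / 8) * Real.exp (-(L / 2))) := by rw [hsqε]; ring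
      _ = _ := by rw [← Real.exp_add]; ring_nf
  have hrpow : (γ * ε) ^ (1 / 4 : ℝ) = Real.sqrt (γ / 2) * Real.exp (-(L / 4)) := by
    have h1 : γ * ε = (Real.sqrt (γ / 2) * Real.exp (-(L / 4))) ^ 4 := by
      have h2 : Real.sqrt (γ / 2) ^ 4 = (γ / 2) ^ 2 := by
        rw [show (4 : ℕ) = 2 * 2 from rfl, pow_mul, Real.sq_sqrt (by positivity)]
      rw [mul_pow, h2, ← Real.exp_nat_mul, hεL]
      push_cast
      ring_nf
    rw [h1, show (1 / 4 : ℝ) = ((4 : ℕ) : ℝ)⁻¹ by norm_num,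
      Real.pow_rpow_inv_natCast (by positivity) (by norm_num)]
  have hfirst : 24 * (Real.sqrt (2 * Real.pi))⁻¹ / (Real.pi * (Real.sqrt (γ * L) / 2))
      = 24 / Real.pi ^ (3 / 2 : ℝ) * Real.sqrt (2 / (γ * L)) := by
    have h1 : Real.pi ^ (3 / 2 : ℝ) = Real.pi * Real.sqrt Real.pi := by
      rw [Real.sqrt_eq_rpow, ← Real.rpow_one_add' Real.pi_pos.le (by norm_num)]
      norm_num
    have h2 : Real.sqrt 2 ^ 2 = 2 := Real.sq_sqrt zero_le_two
    rw [h1, Real.sqrt_div zero_le_two, Real.sqrt_mul zero_le_two]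
    field_simp
    linarith
  have hmain := ksDist_gaussianReal_le_of_charFun (P := μ.map X)
    (B := Real.sqrt γ * Real.exp (-(3 * L / 8))) (by positivity) hT
    (norm_charFun_sub_charFun_gaussianReal_le_sq hX hmean hvar) hunif
  rw [hT2, hfirst] at hmain
  rw [hrpow]
  have hnum := mul_le_mul_of_nonneg_left (two_mul_mul_log_le hγ hL) (inv_nonneg.2 Real.pi_pos.le)
  calc _ ≤ _ := hmain
    _ ≤ _ := add_le_add_left hnum _
    _ = _ := by ring
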